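/- Let $\alpha>0$ and let $G=(G_t)_{t\ge 0}$ be a real-valued centered Gaussian process that is continuous in probability, with covariance function $c(s,t):=\mathbb{E}[G_sG_t]$. Its Lamperti transform is the process $\tilde G_y:=e^{-\alpha y/2}G_{e^y}$, $y\in\mathbb{R}$. Equality in law of processes means equality of their finite-dimensional distributions. The following properties are equivalent: 1. $G$ is an $\alpha$-IDT process, that is, for every integer $n\ge 1$, $$(G_{n^{1/\alpha}t})_{t\ge 0}\overset{(law)}{=}(G^{(1)}_t+\cdots+G^{(n)}_t)_{t\ge 0},$$ where $G^{(1)},\dots,G^{(n)}$ are independent copies of $G$. 2. $c(as,at)=a^{\alpha}c(s,t)$ for all $a>0$ and all $0\le s\le t$. 3. $G$ is self-similar of order $\alpha/2$, that is, for every $a>0$, $(G_{at})_{t\ge 0}\overset{(law)}{=}(a^{\alpha/2}G_t)_{t\ge 0}$. 4. The process $(\tilde G_y)_{y\in\mathbb{R}}$ is (strictly) stationary. 5. There is a finite, positive, symmetric Borel measure $\mu$ on $\mathbb{R}$ such that $$\mathbb{E}[\tilde G_y\tilde G_z]=\int_{\mathbb{R}} e^{iu|y-z|}\,\mu(du)\qquad\text{for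 all } y,z\in\mathbb{R}.$$ Moreover, under these equivalent conditions, for every measure $\mu$ as in (5), the covariance function of $G$ is given by $$c(s,t)=(st)^{\alpha/2}\int_{\mathbb{R}} e^{iu|\ln(s/t)|}\,\mu(du)\qquad\text{for all } s,t>0,$$ and $c(s,t)=0$ whenever $s=0$ or $t=0$. -/

import Mathlib

open MeasureTheory ProbabilityTheory Filter Topology
open scoped NNReal

noncomputable section

namespace AlphaIDT

/-- Two real processes with the same index set have the same law: their path maps, as random
elements of the product space `T → ℝ` with its product σ-algebra, are identically distributed
(equivalently, the processes have the same finite-dimensional distributions). -/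
def SameLaw {T Ω Ω' : Type*} [MeasurableSpace Ω] [MeasurableSpace Ω']
    (X : T → Ω → ℝ) (P : Measure Ω) (Y : T → Ω' → ℝ) (P' : Measure Ω') : Prop :=
  IdentDistrib (fun ω t ↦ X t ω) (fun ω t ↦ Y t ω) P P'

/-- The `i`-th coordinate copy `X⁽ⁱ⁾_t (ω₁, …, ωₙ) = X_t (ωᵢ)` of the process `X`, on the `n`-fold
product of its probability space. Under the product measure these `n` processes are independent
and each of them has the law of `X`. -/
def indepCopy {T Ω : Type*} (X : T → Ω → ℝ) {n : ℕ} (i : Fin n) : T → (Fin n → Ω) → ℝ :=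
  fun t ω ↦ X t (ω i)

/-- `X` is an `α`-IDT process: for every `n ≥ 1`, the process `(X_{n^{1/α} t})_{t ≥ 0}` has the same
law as the sum `(X⁽¹⁾_t + ⋯ + X⁽ⁿ⁾_t)_{t ≥ 0}` of `n` independent copies of `X`. -/
def IsIDT {Ω : Type*} [MeasurableSpace Ω] (α : ℝ) (X : ℝ≥0 → Ω → ℝ) (P : Measure Ω) : Prop :=
  ∀ n : ℕ, 1 ≤ n →
    SameLaw (fun t ↦ X ((n : ℝ≥0) ^ (1 / α) * t)) P
      (fun t ω ↦ ∑ i : Fin n, indepCopy X i t ω) (Measure.pi fun _ : Fin n ↦ P)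

/-- The process `X` is self-similar of order `h`: for every `a > 0`, the processes
`(X_{at})_{t ≥ 0}` and `(a^h X_t)_{t ≥ 0}` have the same law. -/
def IsSelfSimilar {Ω : Type*} [MeasurableSpace Ω] (h : ℝ) (X : ℝ≥0 → Ω → ℝ) (P : Measure Ω) :
    Prop :=
  ∀ a : ℝ≥0, 0 < a → SameLaw (fun t ↦ X (a * t)) P (fun t ω ↦ (a : ℝ) ^ h * X t ω) P

/-- The process `(Y_y)_{y ∈ ℝ}` is (strictly) stationary: its law is invariant under all shifts of
the time parameter. -/
def IsStationary {Ω : Type*} [MeasurableSpace Ω] (Y : ℝ → Ω → ℝ) (P : Measure Ω) : Prop :=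
  ∀ r : ℝ, SameLaw (fun y ↦ Y (y + r)) P Y P

/-- The Lamperti transform of order `h` of `X`: the process `y ↦ e^{-h y} X_{e^y}` on `ℝ`. -/
def lamperti {Ω : Type*} (h : ℝ) (X : ℝ≥0 → Ω → ℝ) : ℝ → Ω → ℝ :=
  fun y ω ↦ Real.exp (-h * y) * X ⟨Real.exp y, (Real.exp_pos y).le⟩ ω

/-- The function `(s, t) ↦ E[X_s X_t]`, the covariance function of a centered process. -/
def covFun {T Ω : Type*} [MeasurableSpace Ω] (X : T → Ω → ℝ) (P : Measure Ω) (s t : T) : ℝ :=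
  ∫ ω, X s ω * X t ω ∂P

/-- `μ` is a finite, symmetric (positive) measure on `ℝ` such that
`E[Y_y Y_z] = ∫ e^{i u |y - z|} μ(du)` for all real `y`, `z`. -/
structure IsSpectralMeasure {Ω : Type*} [MeasurableSpace Ω] (Y : ℝ → Ω → ℝ) (P : Measure Ω)
    (μ : Measure ℝ) : Prop where
  finite : IsFiniteMeasure μ
  symmetric : μ.map (fun u ↦ -u) = μ
  covFun_eq : ∀ y z : ℝ,
    (covFun Y P y z : ℂ) = ∫ u : ℝ, Complex.exp (Complex.I * u * (|y - z| : ℝ)) ∂μ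

/-- The process `X` is continuous in probability at every time `t ≥ 0`. -/
def IsContinuousInProbability {Ω : Type*} [MeasurableSpace Ω] (X : ℝ≥0 → Ω → ℝ)
    (P : Measure Ω) : Prop :=
  ∀ t : ℝ≥0, TendstoInMeasure P X (𝓝 t) (X t)

end AlphaIDT

end

/-!
Every one of the five properties is equivalent to the homogeneity `c (a s, a t) = a ^ α c (s, t)` of
the covariance function.

The law of a centered Gaussian process is determined by its covariance function
(`sameLaw_of_covFun_eq`), and a sum of `n` independent copies of `G` is a centered Gaussian process
with covariance function `n c` (`covFun_sum_indepCopy`). So the IDT property, self-similarity and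
stationarity of the Lamperti transform are identities between covariance functions. Self-similarity
is homogeneity, stationarity is its form in logarithmic time, and the IDT property is homogeneity
restricted to the factors `a = n ^ (1 / α)`. The latter extends from integers `a ^ α` to rationals
and then to all positive reals, because continuity in probability makes `c` continuous
(`continuous_covFun`): convergence in probability of Gaussian variables gives convergence of their
characteristic functions at `1`, hence of their variances.

The Lamperti transform only sees positive times. At time `0` one has `c (0, 0) = lim c (t, t) = lim
t ^ α c (1, 1) = 0`, so that `G 0 = 0` almost surely (`covFun_zero_left`).

A spectral measure makes the covariance of the Lamperti transform translation invariant. The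
converse is Bochner's theorem (`IsPosDefFun.exists_charFun_eq`) for a continuous even positive
definite function `r`. Averaging the quadratic form of `r (x) cos (u x)` at `n` independent Gaussian
points and letting `n` grow shows that `r` times a Gaussian has a nonnegative Fourier transform
(`IsPosDefFun.integral_gaussianReal_nonneg`). Such a transform is integrable by Fatou's lemma
(`integrable_fourier_of_nonneg`), so by Fourier inversion the product is the characteristic function
of a finite measure. Widening the Gaussian and passing to the limit, with tightness coming from the
continuity of `r` at `0`, gives `r` itself.
-/

namespace AlphaIDT

/-! ### Laws of centered Gaussian processes -/

section GaussianLaw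

variable {T Ω Ω' : Type*} [MeasurableSpace Ω] [MeasurableSpace Ω'] {P : Measure Ω}
  {P' : Measure Ω'} {X : T → Ω → ℝ} {Y : T → Ω' → ℝ}

lemma covFun_comm (X : T → Ω → ℝ) (P : Measure Ω) (s t : T) : covFun X P s t = covFun X P t s := by
  simp only [covFun, mul_comm]

lemma SameLaw.covFun_eq (h : SameLaw X P Y P') (s t : T) : covFun X P s t = covFun Y P' s t := by
  have hm : Measurable fun x : T → ℝ ↦ x s * x t := by fun_prop
  exact (IdentDistrib.comp h hm).integral_eq

lemma covFun_eq_covariance (hX : ∀ t, ∫ ω, X t ω ∂P = 0) (s t : T) :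
    covFun X P s t = cov[X s, X t; P] := by
  simp [covFun, covariance, hX]

lemma _root_.ProbabilityTheory.IsGaussianProcess.memLp_two (hX : IsGaussianProcess X P) (t : T) :
    MemLp (X t) 2 P := (hX.hasGaussianLaw_eval t).memLp_two

lemma _root_.ProbabilityTheory.IsGaussianProcess.integrable_mul (hX : IsGaussianProcess X P)
    (s t : T) : Integrable (fun ω ↦ X s ω * X t ω) P :=
  (hX.memLp_two s).integrable_mul (hX.memLp_two t)

/-- The characteristic function of the finite-dimensional distributions of a centered Gaussian
process, as a function of its covariance. -/
lemma charFunDual_map_restrict (hX : IsGaussianProcess X P) (hX0 : ∀ t, ∫ ω, X t ω ∂P = 0)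
    (I : Finset T) (L : StrongDual ℝ (I → ℝ)) [DecidableEq I] :
    charFunDual (P.map fun ω ↦ I.restrict (X · ω)) L =
      Complex.exp (-(∑ i : I, ∑ j : I,
        L (Pi.single i 1) * L (Pi.single j 1) * covFun X P i j : ℝ) / 2) := by
  have := hX.isProbabilityMeasure
  have hL : ∀ ω, L (I.restrict (X · ω)) = ∑ i : I, L (Pi.single i 1) * X i ω := by
    intro ω
    conv_lhs => rw [pi_eq_sum_univ' (I.restrict (X · ω)), map_sum]
    refine Finset.sum_congr rfl fun i _ ↦ ?_
    rw [map_smul, smul_eq_mul, mul_comm]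
    rfl
  rw [(hX.hasGaussianLaw I).charFunDual_map_eq_fun]
  simp only [hL]
  have hmem : ∀ i : I, MemLp (fun ω ↦ L (Pi.single i 1) * X i ω) 2 P :=
    fun i ↦ (hX.memLp_two i).const_mul _
  have h0 : ∫ ω, ∑ i : I, L (Pi.single i 1) * X i ω ∂P = 0 := by
    rw [integral_finsetSum _ fun i _ ↦ (hmem i).integrable one_le_two]
    simp [integral_const_mul, hX0]
  rw [h0, variance_fun_sum hmem]
  simp only [covariance_const_mul_left, covariance_const_mul_right,
    fun i j ↦ covFun_eq_covariance hX0 i j]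
  simp [mul_assoc, mul_left_comm, neg_div]

/-- The law of a centered Gaussian process is determined by its covariance function. -/
lemma sameLaw_of_covFun_eq (hX : IsGaussianProcess X P) (hXm : ∀ t, Measurable (X t))
    (hX0 : ∀ t, ∫ ω, X t ω ∂P = 0) (hY : IsGaussianProcess Y P') (hYm : ∀ t, Measurable (Y t))
    (hY0 : ∀ t, ∫ ω, Y t ω ∂P' = 0) (h : ∀ s t, covFun X P s t = covFun Y P' s t) :
    SameLaw X P Y P' := by
  classical
  have := hX.isProbabilityMeasure
  have := hY.isProbabilityMeasure
  have hXm' : Measurable fun ω ↦ (X · ω) := measurable_pi_lambda _ hXm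
  have hYm' : Measurable fun ω ↦ (Y · ω) := measurable_pi_lambda _ hYm
  refine ⟨hXm'.aemeasurable, hYm'.aemeasurable, ?_⟩
  have hfin : ∀ I : Finset T,
      P.map (fun ω ↦ I.restrict (X · ω)) = P'.map (fun ω ↦ I.restrict (Y · ω)) := by
    intro I
    refine Measure.ext_of_charFunDual ?_
    ext L
    simp only [charFunDual_map_restrict hX hX0, charFunDual_map_restrict hY hY0, h]
  have hlim := isProjectiveLimit_map (P := P) hXm'.aemeasurable
  simp_rw [hfin] at hlim
  exact hlim.unique (isProjectiveLimit_map hYm'.aemeasurable)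

end GaussianLaw

/-! ### Sums of independent copies -/

section IndependentCopies

variable {T Ω : Type*} [MeasurableSpace Ω] {P : Measure Ω} {X : T → Ω → ℝ}

lemma isGaussianProcess_sum_indepCopy (hX : IsGaussianProcess X P) (n : ℕ) :
    IsGaussianProcess (fun t ω ↦ ∑ i : Fin n, indepCopy X i t ω)
      (Measure.pi fun _ : Fin n ↦ P) where
  hasGaussianLaw I := by
    have := hX.isProbabilityMeasure
    have hm : AEMeasurable (fun ω ↦ I.restrict (X · ω)) P := (hX.hasGaussianLaw I).aemeasurable
    have hind : iIndepFun (fun (i : Fin n) (ω : Fin n → Ω) ↦ I.restrict (X · (ω i)))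
        (Measure.pi fun _ : Fin n ↦ P) := iIndepFun_pi (fun _ ↦ hm)
    have hlaw : ∀ i : Fin n, HasGaussianLaw (fun ω : Fin n → Ω ↦ I.restrict (X · (ω i)))
        (Measure.pi fun _ : Fin n ↦ P) := by
      intro i
      constructor
      have h := (hX.hasGaussianLaw I).isGaussian_map
      rwa [← (measurePreserving_eval (fun _ : Fin n ↦ P) i).map_eq,
        AEMeasurable.map_map_of_aemeasurable] at h
      · rwa [(measurePreserving_eval (fun _ : Fin n ↦ P) i).map_eq]
      · exact (measurable_pi_apply i).aemeasurable
    convert! hind.hasGaussianLaw_fun_sum hlaw using 2 with ω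
    ext t
    simp [indepCopy]

variable [IsProbabilityMeasure P]

lemma integral_indepCopy (hX : IsGaussianProcess X P) {n : ℕ} (i : Fin n) (t : T) :
    ∫ ω, indepCopy X i t ω ∂(Measure.pi fun _ : Fin n ↦ P) = ∫ ω, X t ω ∂P :=
  integral_comp_eval (μ := fun _ : Fin n ↦ P) (i := i) (f := X t)
    (hX.memLp_two t).aestronglyMeasurable

lemma memLp_indepCopy (hX : IsGaussianProcess X P) {n : ℕ} (i : Fin n) (t : T) :
    MemLp (indepCopy X i t) 2 (Measure.pi fun _ : Fin n ↦ P) :=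
  (hX.memLp_two t).comp_measurePreserving (measurePreserving_eval (fun _ : Fin n ↦ P) i)

lemma integral_sum_indepCopy (hX : IsGaussianProcess X P) (hX0 : ∀ t, ∫ ω, X t ω ∂P = 0) (n : ℕ)
    (t : T) : ∫ ω, ∑ i : Fin n, indepCopy X i t ω ∂(Measure.pi fun _ : Fin n ↦ P) = 0 := by
  rw [integral_finsetSum _ fun i _ ↦ (memLp_indepCopy hX i t).integrable one_le_two]
  simp [integral_indepCopy hX, hX0]

lemma covFun_sum_indepCopy (hX : IsGaussianProcess X P) (hX0 : ∀ t, ∫ ω, X t ω ∂P = 0) (n : ℕ)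
    (s t : T) :
    covFun (fun t ω ↦ ∑ i : Fin n, indepCopy X i t ω) (Measure.pi fun _ : Fin n ↦ P) s t =
      n * covFun X P s t := by
  have key : ∀ i j : Fin n, ∫ ω, indepCopy X i s ω * indepCopy X j t ω
      ∂(Measure.pi fun _ : Fin n ↦ P) = if i = j then covFun X P s t else 0 := by
    intro i j
    split_ifs with hij
    · subst hij
      exact integral_comp_eval (μ := fun _ : Fin n ↦ P) (i := i) (f := fun ω ↦ X s ω * X t ω)
        (hX.integrable_mul s t).aestronglyMeasurable
    · have hind : iIndepFun (fun (i : Fin n) (ω : Fin n → Ω) (u : ({s, t} : Set T)) ↦ X u (ω i))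
          (Measure.pi fun _ : Fin n ↦ P) :=
        iIndepFun_pi (X := fun _ ω (u : ({s, t} : Set T)) ↦ X u ω)
          fun _ ↦ aemeasurable_pi_lambda _ fun u ↦ hX.aemeasurable u
      have hst := (hind.indepFun hij).comp (measurable_pi_apply ⟨s, by simp⟩)
        (measurable_pi_apply ⟨t, by simp⟩)
      refine (hst.integral_fun_mul_eq_mul_integral
        (memLp_indepCopy hX i s).aestronglyMeasurable
        (memLp_indepCopy hX j t).aestronglyMeasurable).trans ?_
      exact mul_eq_zero_of_left ((integral_indepCopy hX i s).trans (hX0 s)) _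
  have hint : ∀ i j : Fin n, Integrable (fun ω ↦ indepCopy X i s ω * indepCopy X j t ω)
      (Measure.pi fun _ : Fin n ↦ P) :=
    fun i j ↦ (memLp_indepCopy hX i s).integrable_mul (memLp_indepCopy hX j t)
  have hexp : covFun (fun t ω ↦ ∑ i : Fin n, indepCopy X i t ω) (Measure.pi fun _ : Fin n ↦ P) s t
      = ∑ i : Fin n, ∑ j : Fin n, ∫ ω, indepCopy X i s ω * indepCopy X j t ω
        ∂(Measure.pi fun _ : Fin n ↦ P) := by
    simp only [covFun, Finset.sum_mul_sum]
    rw [integral_finsetSum _ fun i _ ↦ integrable_finsetSum _ fun j _ ↦ hint i j]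
    exact Finset.sum_congr rfl fun i _ ↦ integral_finsetSum _ fun j _ ↦ hint i j
  rw [hexp]
  simp [key]

end IndependentCopies

/-! ### Continuity of the covariance function -/

section Continuity

variable {T Ω : Type*} [TopologicalSpace T] [FirstCountableTopology T] [MeasurableSpace Ω]
  {P : Measure Ω} {X : T → Ω → ℝ}

/-- For centered Gaussian variables, convergence in measure implies convergence of the variances,
which are read off from the characteristic functions at `1`. -/
lemma tendsto_integral_sq_of_tendstoInMeasure [IsProbabilityMeasure P] {ι : Type*} {l : Filter ι}
    [l.IsCountablyGenerated] {Z : ι → Ω → ℝ} {Z₀ : Ω → ℝ} (h : TendstoInMeasure P Z l Z₀)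
    (hZ : ∀ i, HasGaussianLaw (Z i) P) (hZ0 : ∀ i, ∫ ω, Z i ω ∂P = 0)
    (hZ₀ : HasGaussianLaw Z₀ P) (hZ₀0 : ∫ ω, Z₀ ω ∂P = 0) :
    Tendsto (fun i ↦ ∫ ω, Z i ω ^ 2 ∂P) l (𝓝 (∫ ω, Z₀ ω ^ 2 ∂P)) := by
  have hchar : ∀ W : Ω → ℝ, HasGaussianLaw W P → ∫ ω, W ω ∂P = 0 →
      charFun (P.map W) 1 = (Real.exp (-(∫ ω, W ω ^ 2 ∂P) / 2) : ℝ) := by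
    intro W hW hW0
    rw [hW.charFun_map_eq]
    simp [hW0, variance_eq_integral hW.aemeasurable, neg_div]
  have hd := (h.tendstoInDistribution_of_aemeasurable (fun i ↦ (hZ i).aemeasurable)
    hZ₀.aemeasurable).tendsto
  have h1 := (ProbabilityMeasure.tendsto_iff_forall_integral_rclike_tendsto ℂ).1 hd
    (BoundedContinuousFunction.innerProbChar (1 : ℝ))
  have h2 : Tendsto (fun i ↦ charFun (P.map (Z i)) 1) l (𝓝 (charFun (P.map Z₀) 1)) := by
    simp only [charFun_eq_integral_innerProbChar]
    exact h1
  rw [hchar _ hZ₀ hZ₀0] at h2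
  simp_rw [fun i ↦ hchar _ (hZ i) (hZ0 i)] at h2
  have h3 := (Complex.continuous_re.tendsto _).comp h2
  simp only [Function.comp_def, Complex.ofReal_re] at h3
  have h4 := ((Real.continuousAt_log (Real.exp_ne_zero _)).tendsto.comp h3).const_mul (-2)
  simp only [Function.comp_def, Real.log_exp] at h4
  convert! h4 using 2 <;> ring

/-- The covariance function of a centered Gaussian process that is continuous in probability is
jointly continuous. By polarization it suffices to consider the second moments of `X s + X t`,
which are continuous functions of its characteristic function at `1`. -/
lemma continuous_covFun (hX : IsGaussianProcess X P) (hX0 : ∀ t, ∫ ω, X t ω ∂P = 0)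
    (hc : ∀ t, TendstoInMeasure P X (𝓝 t) (X t)) :
    Continuous fun p : T × T ↦ covFun X P p.1 p.2 := by
  have := hX.isProbabilityMeasure
  have hpol : ∀ s t, covFun X P s t = ((∫ ω, (X s ω + X t ω) ^ 2 ∂P) - (∫ ω, X s ω ^ 2 ∂P)
      - ∫ ω, X t ω ^ 2 ∂P) / 2 := by
    intro s t
    have h1 := (hX.memLp_two s).integrable_sq
    have h2 := (hX.memLp_two t).integrable_sq
    have h3 := hX.integrable_mul s t
    have hexp : ∫ ω, (X s ω + X t ω) ^ 2 ∂P =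
        ∫ ω, X s ω ^ 2 ∂P + ∫ ω, X t ω ^ 2 ∂P + 2 * ∫ ω, X s ω * X t ω ∂P := by
      rw [← integral_const_mul, ← integral_add h1 h2, ← integral_add (h1.fun_add h2)
        (h3.const_mul 2)]
      congr with ω; ring
    rw [hexp, covFun]
    ring
  have hsq : Continuous fun t ↦ ∫ ω, X t ω ^ 2 ∂P := by
    rw [continuous_iff_continuousAt]
    exact fun t ↦ tendsto_integral_sq_of_tendstoInMeasure (hc t) hX.hasGaussianLaw_eval hX0
      (hX.hasGaussianLaw_eval t) (hX0 t)
  have hadd : Continuous fun p : T × T ↦ ∫ ω, (X p.1 ω + X p.2 ω) ^ 2 ∂P := by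
    rw [continuous_iff_continuousAt]
    intro p
    have h0 : ∀ q : T × T, ∫ ω, X q.1 ω + X q.2 ω ∂P = 0 := by
      intro q
      rw [integral_add (hX.hasGaussianLaw_eval _).integrable (hX.hasGaussianLaw_eval _).integrable,
        hX0, hX0, add_zero]
    refine tendsto_integral_sq_of_tendstoInMeasure (Z := fun (q : T × T) ω ↦ X q.1 ω + X q.2 ω) ?_
      (fun q ↦ hX.hasGaussianLaw_fun_add) h0 hX.hasGaussianLaw_fun_add (h0 p)
    have hf := (hc p.1).comp (continuous_fst.tendsto p)
    have hg := (hc p.2).comp (continuous_snd.tendsto p)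
    rw [tendstoInMeasure_iff_norm] at hf hg ⊢
    intro ε hε
    have hsum := (hf (ε / 2) (by positivity)).add (hg (ε / 2) (by positivity))
    rw [add_zero] at hsum
    refine tendsto_of_tendsto_of_tendsto_of_le_of_le tendsto_const_nhds hsum
      (fun _ ↦ zero_le) fun q ↦ (measure_mono ?_).trans (measure_union_le _ _)
    intro ω hω
    simp only [Set.mem_union, Set.mem_ofPred_eq, Function.comp_apply] at hω ⊢
    by_contra! hlt
    have := norm_add_le (X q.1 ω - X p.1 ω) (X q.2 ω - X p.2 ω)
    rw [← add_sub_add_comm] at this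
    linarith [hlt.1, hlt.2]
  simp_rw [hpol]
  exact ((hadd.sub (hsq.comp continuous_fst)).sub (hsq.comp continuous_snd)).div_const 2

end Continuity

/-! ### Bochner's theorem on the line -/

section Bochner

open scoped FourierTransform ENNReal

/-- A real function `r` is positive definite if the kernel `(x, y) ↦ r (x - y)` has nonnegative
quadratic forms. (Evenness is not part of this notion.) -/
def IsPosDefFun (r : ℝ → ℝ) : Prop :=
  ∀ (n : ℕ) (x c : Fin n → ℝ), 0 ≤ ∑ i, ∑ j, c i * c j * r (x i - x j)

variable {r : ℝ → ℝ}

lemma IsPosDefFun.nonneg_zero (hr : IsPosDefFun r) : 0 ≤ r 0 := by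
  simpa using hr 1 (fun _ ↦ 0) (fun _ ↦ 1)

lemma IsPosDefFun.abs_le (hr : IsPosDefFun r) (heven : ∀ x, r (-x) = r x) (x : ℝ) :
    |r x| ≤ r 0 := by
  have h1 := hr 2 ![x, 0] ![1, 1]
  have h2 := hr 2 ![x, 0] ![1, -1]
  simp [Fin.sum_univ_two, heven] at h1 h2
  rw [_root_.abs_le]
  constructor <;> linarith

/-- Products with cosines preserve positive definiteness, because `cos (u (x - y))` is the sum of
the two rank-one kernels `cos (u x) cos (u y)` and `sin (u x) sin (u y)`. -/
lemma IsPosDefFun.mul_cos (hr : IsPosDefFun r) (u : ℝ) :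
    IsPosDefFun fun x ↦ r x * Real.cos (u * x) := by
  intro n x c
  have h1 := hr n x fun i ↦ c i * Real.cos (u * x i)
  have h2 := hr n x fun i ↦ c i * Real.sin (u * x i)
  refine (add_nonneg h1 h2).trans_eq ?_
  simp only [← Finset.sum_add_distrib]
  refine Finset.sum_congr rfl fun i _ ↦ Finset.sum_congr rfl fun j _ ↦ ?_
  rw [mul_sub, Real.cos_sub]
  ring

/-- The integral of a bounded continuous positive definite function against a centered Gaussian
density is nonnegative. Averaging the quadratic form at `n` independent Gaussian points gives
`n r(0) + n (n - 1) E[r(X - Y)] ≥ 0`, and one divides by `n ^ 2`. -/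
lemma IsPosDefFun.integral_gaussianReal_nonneg (hr : IsPosDefFun r) (hc : Continuous r)
    {C : ℝ} (hC : ∀ x, |r x| ≤ C) (v : ℝ≥0) : 0 ≤ ∫ x, r x ∂(gaussianReal 0 (v + v)) := by
  set ρ := gaussianReal 0 v
  set J := ∫ x, r x ∂(gaussianReal 0 (v + v))
  have hpair : ∀ (n : ℕ) (i j : Fin n), i ≠ j →
      ∫ x : Fin n → ℝ, r (x i - x j) ∂(Measure.pi fun _ ↦ ρ) = J := by
    intro n i j hij
    have hind : iIndepFun (fun (k : Fin n) (x : Fin n → ℝ) ↦ x k) (Measure.pi fun _ ↦ ρ) :=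
      iIndepFun_pi (X := fun _ x ↦ x) fun _ ↦ aemeasurable_id
    have hi := (measurePreserving_eval (fun _ : Fin n ↦ ρ) i).map_eq
    have hj := (measurePreserving_eval (fun _ : Fin n ↦ ρ) j).map_eq
    have hj' : (Measure.pi fun _ : Fin n ↦ ρ).map (fun x ↦ - x j) = gaussianReal 0 v := by
      have h := gaussianReal_map_neg (μ := 0) (v := v)
      rw [neg_zero] at h
      refine Eq.trans ?_ ((congrArg (Measure.map fun x ↦ -x) hj).trans h)
      rw [Measure.map_map (by fun_prop) (by fun_prop)]
      rfl
    have hsum : (Measure.pi fun _ : Fin n ↦ ρ).map (fun x ↦ x i - x j) =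
        gaussianReal 0 (v + v) := by
      have h := gaussianReal_add_gaussianReal_of_indepFun
        ((hind.indepFun hij).comp measurable_id measurable_neg) hi hj'
      rw [add_zero] at h
      simpa [sub_eq_add_neg, Function.comp_def, Pi.add_def] using! h
    rw [← integral_map (f := r) (φ := fun x : Fin n → ℝ ↦ x i - x j) (by fun_prop)
      hc.aestronglyMeasurable, hsum]
  have hn : ∀ n : ℕ, 0 ≤ n * r 0 + n * (n - 1) * J := by
    intro n
    have h0 : 0 ≤ ∫ x : Fin n → ℝ, ∑ i, ∑ j, r (x i - x j) ∂(Measure.pi fun _ ↦ ρ) :=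
      integral_nonneg fun x ↦ by simpa using hr n x fun _ ↦ 1
    have hint : ∀ i j : Fin n, Integrable (fun x : Fin n → ℝ ↦ r (x i - x j))
        (Measure.pi fun _ ↦ ρ) := fun i j ↦
      Integrable.of_bound (by fun_prop) C (ae_of_all _ fun x ↦ hC _)
    rw [integral_finsetSum _ fun i _ ↦ integrable_finsetSum _ fun j _ ↦ hint i j] at h0
    have hval : ∀ i : Fin n, ∫ x : Fin n → ℝ, ∑ j, r (x i - x j) ∂(Measure.pi fun _ ↦ ρ) =
        r 0 + (n - 1) * J := by
      intro i
      rw [integral_finsetSum _ fun j _ ↦ hint i j, ← Finset.add_sum_erase _ _ (Finset.mem_univ i),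
        Finset.sum_congr rfl fun j hj ↦ hpair n i j (Finset.ne_of_mem_erase hj).symm]
      have : 1 ≤ n := Fin.pos i
      simp [Finset.card_erase_of_mem, Nat.cast_sub this]
    simp only [hval, Finset.sum_const, Finset.card_univ, Fintype.card_fin, nsmul_eq_mul] at h0
    linarith
  -- if `J < 0`, the quadratic term in `n` dominates
  by_contra! hJ
  obtain ⟨n, hn'⟩ := exists_nat_gt (1 + r 0 / (-J))
  have hJ' : 0 < -J := by linarith
  have hn0 : (0 : ℝ) < n := by
    have := div_nonneg hr.nonneg_zero hJ'.le
    linarith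
  have h1 : r 0 < (n - 1) * (-J) := by
    rw [← div_lt_iff₀ hJ']
    linarith
  nlinarith [hn n]

/-- An integrable function that is continuous at `0` and has a nonnegative Fourier transform has an
integrable Fourier transform: the integrals of `𝓕 f` against wider and wider Gaussians converge to
`f 0`, and Fatou's lemma applies. -/
lemma integrable_fourier_of_nonneg {f : ℝ → ℂ} (hf : Integrable f) (hf0 : ContinuousAt f 0)
    (hpos : ∀ w, 0 ≤ (𝓕 f w).re) (him : ∀ w, (𝓕 f w).im = 0) : Integrable (𝓕 f) := by
  have hF : ∀ w, 𝓕 f w = ((𝓕 f w).re : ℂ) := fun w ↦ Complex.ext rfl (by simp [him])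
  have hcont : Continuous (𝓕 f) := by
    exact VectorFourier.fourierIntegral_continuous Real.continuous_fourierChar continuous_inner hf
  have hlim : Tendsto (fun c : ℝ ↦ ∫ w : ℝ, Complex.exp (-c⁻¹ * ‖w‖ ^ 2) • 𝓕 f w) atTop
      (𝓝 (f 0)) := by
    refine (Real.tendsto_integral_gaussian_smul' hf hf0).congr' ?_
    filter_upwards [Ioi_mem_atTop 0] with c (hc : 0 < c)
    have J : Integrable (fun w : ℝ ↦ Complex.exp (-c⁻¹ * ‖w‖ ^ 2)) := by
      simpa using GaussianFourier.integrable_cexp_neg_mul_sq_norm_add (V := ℝ) (b := (c⁻¹ : ℂ))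
        (by simpa) 0 0
    have h : ∫ w : ℝ, 𝓕 (fun w : ℝ ↦ Complex.exp (-c⁻¹ * ‖w‖ ^ 2)) w • f w =
        ∫ w : ℝ, Complex.exp (-c⁻¹ * ‖w‖ ^ 2) • 𝓕 f w := by
      simpa using! VectorFourier.integral_fourierIntegral_smul_eq_flip (L := innerₗ ℝ)
        Real.continuous_fourierChar continuous_inner J hf
    rw [← h]
    congr with w
    have hg := fourier_gaussian_innerProductSpace (V := ℝ) (b := (c⁻¹ : ℝ)) (by simpa) w
    rw [Complex.ofReal_inv] at hg
    rw [Complex.ofReal_inv, hg]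
    simp only [zero_sub, norm_neg, div_inv_eq_mul]
    congr 3
    ring
  have hre : Tendsto (fun n : ℕ ↦ ∫ w : ℝ, Real.exp (-(n : ℝ)⁻¹ * w ^ 2) * (𝓕 f w).re) atTop
      (𝓝 (f 0).re) := by
    refine ((Complex.continuous_re.tendsto _).comp
      (hlim.comp tendsto_natCast_atTop_atTop)).congr fun n ↦ ?_
    simp only [Function.comp_apply]
    rw [← Complex.ofReal_re (∫ w : ℝ, _), ← integral_complex_ofReal]
    congr 2 with w
    conv_lhs => rw [hF w]
    simp [← Complex.ofReal_pow]
  have hG : ∀ n : ℕ, Continuous fun w : ℝ ↦ Real.exp (-(n : ℝ)⁻¹ * w ^ 2) * (𝓕 f w).re :=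
    fun n ↦ by fun_prop
  have hnn : ∀ (n : ℕ) (w : ℝ), 0 ≤ Real.exp (-(n : ℝ)⁻¹ * w ^ 2) * (𝓕 f w).re :=
    fun n w ↦ mul_nonneg (Real.exp_pos _).le (hpos w)
  have hint : ∀ n : ℕ, 0 < n →
      Integrable fun w : ℝ ↦ Real.exp (-(n : ℝ)⁻¹ * w ^ 2) * (𝓕 f w).re := by
    intro n hn
    refine (integrable_exp_neg_mul_sq (b := (n : ℝ)⁻¹) (by positivity)).mul_bdd
      (c := ∫ x, ‖f x‖) (by fun_prop) (ae_of_all _ fun w ↦ ?_)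
    exact (Complex.abs_re_le_norm _).trans
      (VectorFourier.norm_fourierIntegral_le_integral_norm _ _ _ _ _)
  have hlint : Tendsto (fun n : ℕ ↦ ∫⁻ w, ‖Real.exp (-(n : ℝ)⁻¹ * w ^ 2) * (𝓕 f w).re‖ₑ) atTop
      (𝓝 (ENNReal.ofReal (f 0).re)) := by
    refine (ENNReal.tendsto_ofReal hre).congr' ?_
    filter_upwards [eventually_gt_atTop 0] with n hn
    rw [ofReal_integral_eq_lintegral_ofReal (hint n hn) (ae_of_all _ (hnn n))]
    exact lintegral_congr fun w ↦ (Real.enorm_of_nonneg (hnn n w)).symm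
  have hreal : Integrable fun w ↦ (𝓕 f w).re := by
    refine integrable_of_tendsto (ae_of_all _ fun w ↦ ?_)
      (fun n ↦ (hG n).aestronglyMeasurable) (hlint.liminf_eq.trans_ne ENNReal.ofReal_ne_top)
    have h0 : Tendsto (fun n : ℕ ↦ -(n : ℝ)⁻¹ * w ^ 2) atTop (𝓝 0) := by
      simpa using (tendsto_inv_atTop_nhds_zero_nat (𝕜 := ℝ)).neg.mul_const (w ^ 2)
    simpa using ((Real.continuous_exp.tendsto _).comp h0).mul_const (𝓕 f w).re
  exact hreal.ofReal.congr (ae_of_all _ fun w ↦ (hF w).symm)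

/-- A continuous integrable function with nonnegative Fourier transform is, up to the normalization
of the Fourier transform, the characteristic function of a finite measure, whose density is the
Fourier transform. -/
lemma exists_charFun_eq_of_fourier_nonneg {f : ℝ → ℂ} (hf : Integrable f) (hc : Continuous f)
    (hpos : ∀ w, 0 ≤ (𝓕 f w).re) (him : ∀ w, (𝓕 f w).im = 0) :
    ∃ μ : Measure ℝ, IsFiniteMeasure μ ∧ ∀ t, charFun μ t = f (t / (2 * Real.pi)) := by
  have hint := integrable_fourier_of_nonneg hf hc.continuousAt hpos him
  have hF : ∀ w, 𝓕 f w = ((𝓕 f w).re : ℂ) := fun w ↦ Complex.ext rfl (by simp [him])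
  have hcont : Continuous (𝓕 f) :=
    VectorFourier.fourierIntegral_continuous Real.continuous_fourierChar continuous_inner hf
  refine ⟨volume.withDensity fun w ↦ ENNReal.ofReal (𝓕 f w).re,
    isFiniteMeasure_withDensity_ofReal hint.re.2, fun t ↦ ?_⟩
  rw [charFun_apply_real, integral_withDensity_eq_integral_toReal_smul (by fun_prop)
    (ae_of_all _ fun _ ↦ ENNReal.ofReal_lt_top)]
  rw [← congrFun (hc.fourierInv_fourier_eq hf hint) (t / (2 * Real.pi)), Real.fourierInv_eq']
  congr with w
  rw [ENNReal.toReal_ofReal (hpos w)]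
  conv_rhs => rw [hF w]
  simp only [smul_eq_mul, Complex.real_smul]
  rw [mul_comm]
  congr 2
  simp
  field_simp

lemma fourier_ofReal_of_even {g : ℝ → ℝ} (hg : Integrable g) (heven : ∀ x, g (-x) = g x) (u : ℝ) :
    𝓕 (fun x ↦ (g x : ℂ)) u = (∫ x, Real.cos (2 * Real.pi * u * x) * g x : ℝ) := by
  have hcos : Integrable fun x ↦ Real.cos (2 * Real.pi * u * x) * g x :=
    hg.bdd_mul (c := 1) (by fun_prop) (ae_of_all _ fun x ↦ Real.abs_cos_le_one _)
  have hsin : Integrable fun x ↦ Real.sin (2 * Real.pi * u * x) * g x :=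
    hg.bdd_mul (c := 1) (by fun_prop) (ae_of_all _ fun x ↦ Real.abs_sin_le_one _)
  have hodd : ∫ x, Real.sin (2 * Real.pi * u * x) * g x = 0 := by
    have h := integral_neg_eq_self (fun x ↦ Real.sin (2 * Real.pi * u * x) * g x) volume
    simp only [mul_neg, Real.sin_neg, heven, neg_mul, integral_neg] at h
    linarith
  have hsplit : ∀ x : ℝ,
      Complex.exp (((-2 * Real.pi * inner ℝ x u : ℝ) : ℂ) * Complex.I) • (g x : ℂ) =
        ((Real.cos (2 * Real.pi * u * x) * g x : ℝ) : ℂ)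
        - ((Real.sin (2 * Real.pi * u * x) * g x : ℝ) : ℂ) * Complex.I := by
    intro x
    rw [Complex.exp_mul_I, ← Complex.ofReal_cos, ← Complex.ofReal_sin]
    have : (-2 * Real.pi * inner ℝ x u : ℝ) = -(2 * Real.pi * u * x) := by
      simp
      ring
    rw [this, Real.cos_neg, Real.sin_neg]
    push_cast
    rw [smul_eq_mul]
    ring
  rw [Real.fourier_eq']
  simp_rw [hsplit]
  rw [integral_sub hcos.ofReal (hsin.ofReal.mul_const _), integral_mul_const,
    integral_complex_ofReal, integral_complex_ofReal, hodd]
  simp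

/-- A pointwise limit of characteristic functions of probability measures that is continuous at `0`
is a characteristic function: the measures are tight, so that they accumulate at a probability
measure. -/
lemma exists_charFun_eq_of_tendsto {μ : ℕ → ProbabilityMeasure ℝ} {f : ℝ → ℂ}
    (hf : ContinuousAt f 0)
    (h : ∀ t, Tendsto (fun n ↦ charFun (μ n : Measure ℝ) t) atTop (𝓝 (f t))) :
    ∃ μ₀ : ProbabilityMeasure ℝ, ∀ t, charFun (μ₀ : Measure ℝ) t = f t := by
  have htight : IsTightMeasureSet (Set.range fun n ↦ (μ n : Measure ℝ)) :=
    isTightMeasureSet_of_tendsto_charFun hf h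
  have hcomp : IsCompact (closure (Set.range μ)) := by
    refine isCompact_closure_of_isTightMeasureSet ?_
    convert! htight using 1
    ext ν
    simp
  obtain ⟨μ₀, -, hμ₀ : Tendsto _ _ _⟩ := hcomp.ultrafilter_le_nhds
    ((Filter.hyperfilter ℕ).map μ) (le_principal_iff.2
      (mem_of_superset (mem_map.2 (by simp)) subset_closure))
  -- convergence along an ultrafilter suffices to identify the characteristic function
  refine ⟨μ₀, fun t ↦ ?_⟩
  have h1 := (ProbabilityMeasure.tendsto_iff_forall_integral_rclike_tendsto ℂ).1 hμ₀
    (BoundedContinuousFunction.innerProbChar t)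
  simp only [← charFun_eq_integral_innerProbChar] at h1
  exact tendsto_nhds_unique h1 (tendsto_map'_iff.2 ((h t).mono_left (Nat.hyperfilter_le_atTop)))

/-- The product of a continuous even positive definite function and a Gaussian is, up to scaling, a
characteristic function: its Fourier transform is nonnegative since it is the integral of a positive
definite function against a Gaussian density. -/
lemma IsPosDefFun.exists_charFun_eq_mul_gaussian (hr : IsPosDefFun r) (hc : Continuous r)
    (heven : ∀ x, r (-x) = r x) {v : ℝ≥0} (hv : v ≠ 0) :
    ∃ μ : Measure ℝ, IsFiniteMeasure μ ∧ ∀ t, charFun μ t =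
      (r t * Real.exp (-(t / (2 * Real.pi)) ^ 2 / (2 * (v + v : ℝ≥0))) : ℝ) := by
  have hvv : v + v ≠ 0 := by simpa using hv
  have hvv' : (0 : ℝ) < (v + v : ℝ≥0) := NNReal.coe_pos.2 (pos_iff_ne_zero.2 hvv)
  -- the factor `2 π` translates between the normalizations of `𝓕` and of `charFun`
  set q : ℝ → ℝ := fun x ↦ r (2 * Real.pi * x)
  have hqc : Continuous q := by fun_prop
  have hqpd : IsPosDefFun q := fun n x c ↦ by
    simpa [q, mul_sub] using hr n (fun i ↦ 2 * Real.pi * x i) c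
  have hqb : ∀ x, |q x| ≤ r 0 := fun x ↦ hr.abs_le heven _
  set g : ℝ → ℝ := fun x ↦ q x * Real.exp (-x ^ 2 / (2 * (v + v : ℝ≥0)))
  have hgc : Continuous g := by fun_prop
  have hgint : Integrable g := by
    have h : Integrable fun x : ℝ ↦ Real.exp (-x ^ 2 / (2 * (v + v : ℝ≥0))) := by
      refine (integrable_exp_neg_mul_sq (b := (2 * (v + v : ℝ≥0) : ℝ)⁻¹) (by positivity)).congr
        (ae_of_all _ fun x ↦ ?_)
      dsimp only
      congr 1
      ring
    exact h.bdd_mul (c := r 0) hqc.aestronglyMeasurable (ae_of_all _ hqb)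
  have hgeven : ∀ x, g (-x) = g x := fun x ↦ by simp [g, q, heven]
  have hpos : ∀ u, 0 ≤ ∫ x, Real.cos (2 * Real.pi * u * x) * g x := by
    intro u
    have h := (hqpd.mul_cos (2 * Real.pi * u)).integral_gaussianReal_nonneg (by fun_prop)
      (C := r 0) (fun x ↦ ?_) v
    · rw [integral_gaussianReal_eq_integral_smul hvv] at h
      have hfac : ∀ x, gaussianPDFReal 0 (v + v) x • (q x * Real.cos (2 * Real.pi * u * x)) =
          (√(2 * Real.pi * (v + v : ℝ≥0)))⁻¹ * (Real.cos (2 * Real.pi * u * x) * g x) := by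
        intro x
        simp only [gaussianPDFReal, sub_zero, smul_eq_mul, g]
        ring
      simp_rw [hfac] at h
      rw [integral_const_mul] at h
      exact nonneg_of_mul_nonneg_right h (by positivity)
    · rw [abs_mul]
      exact (mul_le_of_le_one_right (abs_nonneg _) (Real.abs_cos_le_one _)).trans (hqb x)
  have hgC : Integrable fun x ↦ (g x : ℂ) := hgint.ofReal
  obtain ⟨μ, hμ, hμg⟩ := exists_charFun_eq_of_fourier_nonneg hgC
    (Complex.continuous_ofReal.comp hgc)
    (fun w ↦ by rw [fourier_ofReal_of_even hgint hgeven]; exact hpos w)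
    (fun w ↦ by rw [fourier_ofReal_of_even hgint hgeven]; exact Complex.ofReal_im _)
  refine ⟨μ, hμ, fun t ↦ ?_⟩
  rw [hμg]
  have : 2 * Real.pi * (t / (2 * Real.pi)) = t := by field_simp
  simp only [g, q, this]

/-- **Bochner's theorem** for even real functions on the line. -/
theorem IsPosDefFun.exists_charFun_eq (hr : IsPosDefFun r) (hc : Continuous r)
    (heven : ∀ x, r (-x) = r x) :
    ∃ μ : Measure ℝ, IsFiniteMeasure μ ∧ ∀ t, charFun μ t = r t := by
  rcases hr.nonneg_zero.eq_or_lt with h0 | h0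
  · refine ⟨0, inferInstance, fun t ↦ ?_⟩
    have := hr.abs_le heven t
    rw [← h0, abs_nonpos_iff] at this
    simp [this]
  -- normalize `r` so that the approximating measures are probability measures
  have hpd : IsPosDefFun fun x ↦ (r 0)⁻¹ * r x := fun n x c ↦ by
    have h := mul_nonneg (inv_nonneg.2 h0.le) (hr n x c)
    simp only [Finset.mul_sum] at h
    refine h.trans_eq (Finset.sum_congr rfl fun i _ ↦ Finset.sum_congr rfl fun j _ ↦ ?_)
    ring
  have happrox : ∀ n : ℕ, ∃ μ : ProbabilityMeasure ℝ, ∀ t, charFun (μ : Measure ℝ) t =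
      ((r 0)⁻¹ * r t * Real.exp (-(t / (2 * Real.pi)) ^ 2 /
        (2 * ((n + 1 : ℝ≥0) + (n + 1 : ℝ≥0) : ℝ≥0))) : ℝ) := by
    intro n
    obtain ⟨μ, hμ, hμt⟩ := hpd.exists_charFun_eq_mul_gaussian (by fun_prop)
      (fun x ↦ by rw [heven]) (v := n + 1) (by positivity)
    have h1 := hμt 0
    rw [charFun_zero] at h1
    have hprob : IsProbabilityMeasure μ := by
      refine isProbabilityMeasure_iff_real.2 ?_
      have : (μ.real Set.univ : ℂ) = 1 := by rw [h1]; simp [h0.ne']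
      exact_mod_cast this
    exact ⟨⟨μ, hprob⟩, hμt⟩
  choose μ hμ using happrox
  obtain ⟨ν, hν⟩ := exists_charFun_eq_of_tendsto (μ := μ) (f := fun t ↦ (((r 0)⁻¹ * r t : ℝ) : ℂ))
    (by fun_prop) (fun t ↦ by
      simp_rw [hμ]
      refine (Complex.continuous_ofReal.tendsto _).comp ?_
      have hdiv : Tendsto (fun n : ℕ ↦ -(t / (2 * Real.pi)) ^ 2 /
          (2 * ((n + 1 : ℝ≥0) + (n + 1 : ℝ≥0) : ℝ≥0) : ℝ)) atTop (𝓝 0) := by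
        have h := (tendsto_one_div_add_atTop_nhds_zero_nat (𝕜 := ℝ)).const_mul
          (-(t / (2 * Real.pi)) ^ 2 / 4)
        rw [mul_zero] at h
        refine h.congr fun n ↦ ?_
        push_cast
        field_simp
        ring
      simpa using ((Real.continuous_exp.tendsto _).comp hdiv).const_mul ((r 0)⁻¹ * r t))
  refine ⟨(r 0).toNNReal • (ν : Measure ℝ), inferInstance, fun t ↦ ?_⟩
  rw [charFun_apply, integral_smul_nnreal_measure, ← charFun_apply, hν, NNReal.smul_def,
    Real.coe_toNNReal _ h0.le, Complex.real_smul, ← Complex.ofReal_mul]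
  congr 1
  field_simp

end Bochner

/-! ### Homogeneous covariance functions and the Lamperti transform -/

section Scaling

/-- A continuous function on `[0, ∞)` with `F (n a) = n F a` for all positive integers `n` is
linear: this determines `F` at positive rationals, and `⌊n a⌋ / n` tends to `a`. -/
lemma eq_mul_one_of_natCast_mul {F : ℝ≥0 → ℝ} (hF : Continuous F)
    (h : ∀ n : ℕ, 1 ≤ n → ∀ a, F (n * a) = n * F a) (a : ℝ≥0) : F a = a * F 1 := by
  have h0 : F 0 = 0 := by
    have := h 2 (by norm_num) 0
    rw [mul_zero] at this
    push_cast at this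
    linarith
  have hnat : ∀ n : ℕ, F n = n * F 1 := by
    intro n
    rcases Nat.eq_zero_or_pos n with rfl | hn
    · simp [h0]
    · simpa using h n hn 1
  have hlim : Tendsto (fun n : ℕ ↦ (⌊(a : ℝ) * n⌋₊ : ℝ≥0) / n) atTop (𝓝 a) := by
    rw [← NNReal.tendsto_coe]
    push_cast
    exact (tendsto_nat_floor_mul_div_atTop a.coe_nonneg).comp tendsto_natCast_atTop_atTop
  refine tendsto_nhds_unique ((hF.tendsto a).comp hlim) ?_
  refine (((NNReal.continuous_coe.tendsto a).comp hlim).mul_const (F 1)).congr' ?_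
  filter_upwards [eventually_ge_atTop 1] with n hn
  have hn0 : (n : ℝ≥0) ≠ 0 := by positivity
  have hn0' : (n : ℝ) ≠ 0 := by positivity
  have h1 := h n hn (⌊(a : ℝ) * n⌋₊ / n)
  rw [mul_div_cancel₀ _ hn0, hnat] at h1
  simp only [Function.comp_apply]
  refine mul_left_cancel₀ hn0' (Eq.trans ?_ h1)
  push_cast
  field_simp

variable {Ω : Type*} [MeasurableSpace Ω] {P : Measure Ω} {α : ℝ} {G : ℝ≥0 → Ω → ℝ}

/-- The exponential function with values in `ℝ≥0`. -/
noncomputable def nnexp (y : ℝ) : ℝ≥0 := ⟨Real.exp y, (Real.exp_pos y).le⟩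

lemma coe_nnexp (y : ℝ) : (nnexp y : ℝ) = Real.exp y := rfl

lemma nnexp_pos (y : ℝ) : 0 < nnexp y := Real.exp_pos y

lemma nnexp_add (y z : ℝ) : nnexp (y + z) = nnexp y * nnexp z :=
  NNReal.eq (Real.exp_add y z)

lemma nnexp_log {s : ℝ≥0} (hs : 0 < s) : nnexp (Real.log s) = s :=
  NNReal.eq (Real.exp_log hs)

lemma continuous_nnexp : Continuous nnexp := Real.continuous_exp.subtype_mk _

lemma lamperti_apply {Ω : Type*} (h : ℝ) (G : ℝ≥0 → Ω → ℝ) (y : ℝ) (ω : Ω) :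
    lamperti h G y ω = Real.exp (-h * y) * G (nnexp y) ω := rfl

lemma covFun_lamperti (h : ℝ) (G : ℝ≥0 → Ω → ℝ) (P : Measure Ω) (y z : ℝ) :
    covFun (lamperti h G) P y z = Real.exp (-h * (y + z)) *
      covFun G P (nnexp y) (nnexp z) := by
  simp only [covFun, lamperti_apply, ← integral_const_mul]
  congr with ω
  rw [mul_add, Real.exp_add]
  ring

/-- The covariance function in terms of that of the Lamperti transform. -/
lemma covFun_eq_lamperti (h : ℝ) (G : ℝ≥0 → Ω → ℝ) (P : Measure Ω) {s t : ℝ≥0} (hs : 0 < s)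
    (ht : 0 < t) : covFun G P s t =
      ((s : ℝ) * t) ^ h * covFun (lamperti h G) P (Real.log s) (Real.log t) := by
  have hs' : (0 : ℝ) < s := hs
  have ht' : (0 : ℝ) < t := ht
  rw [covFun_lamperti, nnexp_log hs, nnexp_log ht, Real.rpow_def_of_pos (by positivity),
    Real.log_mul hs'.ne' ht'.ne', ← mul_assoc, ← Real.exp_add]
  ring_nf
  simp

/-- If the variance of `G t` is proportional to `t ^ α` for `t > 0`, then it vanishes at `t = 0` by
continuity, so that `G 0 = 0` almost surely. -/
lemma covFun_zero_left (hα : 0 < α) (hG : IsGaussianProcess G P)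
    (hc : Continuous fun p : ℝ≥0 × ℝ≥0 ↦ covFun G P p.1 p.2)
    (h : ∀ a : ℝ≥0, 0 < a → covFun G P a a = (a : ℝ) ^ α * covFun G P 1 1) (t : ℝ≥0) :
    covFun G P 0 t = 0 := by
  have hvar : covFun G P 0 0 = 0 := by
    have hu : Tendsto (fun n : ℕ ↦ (1 / ((n : ℝ≥0) + 1))) atTop (𝓝 0) :=
      tendsto_one_div_add_atTop_nhds_zero_nat
    have h1 := (hc.tendsto (0, 0)).comp (hu.prodMk_nhds hu)
    have h2 : Continuous fun a : ℝ≥0 ↦ (a : ℝ) ^ α * covFun G P 1 1 :=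
      (NNReal.continuous_coe.rpow_const fun _ ↦ Or.inr hα.le).mul_const _
    have h3 := (h2.tendsto 0).comp hu
    refine tendsto_nhds_unique h1 ?_
    simp only [NNReal.coe_zero, Real.zero_rpow hα.ne', zero_mul] at h3
    exact h3.congr fun n ↦ (h _ (by positivity)).symm
  have hae : (fun ω ↦ G 0 ω * G 0 ω) =ᵐ[P] 0 :=
    (integral_eq_zero_iff_of_nonneg (fun ω ↦ mul_self_nonneg _) (hG.integrable_mul 0 0)).1 hvar
  refine integral_eq_zero_of_ae ?_
  filter_upwards [hae] with ω hω
  simp [mul_self_eq_zero.1 hω]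

/-- Homogeneity of the covariance function at positive times extends to all times. -/
lemma covFun_mul_mul_of_pos (hα : 0 < α) (hG : IsGaussianProcess G P)
    (hc : Continuous fun p : ℝ≥0 × ℝ≥0 ↦ covFun G P p.1 p.2)
    (h : ∀ a s t : ℝ≥0, 0 < a → 0 < s → 0 < t →
      covFun G P (a * s) (a * t) = (a : ℝ) ^ α * covFun G P s t)
    (a : ℝ≥0) (ha : 0 < a) (s t : ℝ≥0) :
    covFun G P (a * s) (a * t) = (a : ℝ) ^ α * covFun G P s t := by
  have h0 : ∀ t, covFun G P 0 t = 0 := covFun_zero_left hα hG hc fun a ha ↦ by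
    simpa using h a 1 1 ha one_pos one_pos
  rcases eq_zero_or_pos s with rfl | hs
  · simp [h0]
  rcases eq_zero_or_pos t with rfl | ht
  · rw [mul_zero, covFun_comm, h0, covFun_comm, h0, mul_zero]
  exact h a s t ha hs ht

/-- The covariance of an `α`-IDT process is homogeneous: `b ↦ c (b ^ (1 / α) s, b ^ (1 / α) t)` is
continuous and compatible with multiplication of `b` by positive integers, hence linear. -/
lemma IsIDT.covFun_mul_mul [IsProbabilityMeasure P] (hα : 0 < α) (hG : IsGaussianProcess G P)
    (hG0 : ∀ t, ∫ ω, G t ω ∂P = 0)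
    (hc : Continuous fun p : ℝ≥0 × ℝ≥0 ↦ covFun G P p.1 p.2) (h : IsIDT α G P)
    (a s t : ℝ≥0) : covFun G P (a * s) (a * t) = (a : ℝ) ^ α * covFun G P s t := by
  have hroot : Continuous fun b : ℝ≥0 ↦ b ^ (1 / α) :=
    NNReal.continuous_rpow_const (by positivity)
  have hlin := eq_mul_one_of_natCast_mul
    (F := fun b ↦ covFun G P (b ^ (1 / α) * s) (b ^ (1 / α) * t))
    (hc.comp ((hroot.mul continuous_const).prodMk (hroot.mul continuous_const))) (fun n hn b ↦ by
      have h1 := (h n hn).covFun_eq (b ^ (1 / α) * s) (b ^ (1 / α) * t)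
      rw [covFun_sum_indepCopy hG hG0] at h1
      rw [← h1]
      simp only [covFun, NNReal.mul_rpow, mul_assoc]) (a ^ α)
  simpa [← NNReal.rpow_mul, hα.ne'] using hlin

lemma isIDT_of_covFun_mul_mul [IsProbabilityMeasure P] (hα : 0 < α) (hGm : ∀ t, Measurable (G t))
    (hG : IsGaussianProcess G P) (hG0 : ∀ t, ∫ ω, G t ω ∂P = 0)
    (h : ∀ a : ℝ≥0, 0 < a → ∀ s t : ℝ≥0,
      covFun G P (a * s) (a * t) = (a : ℝ) ^ α * covFun G P s t) : IsIDT α G P := by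
  intro n hn
  refine sameLaw_of_covFun_eq (hG.comp_right fun t ↦ (n : ℝ≥0) ^ (1 / α) * t) (fun t ↦ hGm _)
    (fun t ↦ hG0 _) (isGaussianProcess_sum_indepCopy hG n)
    (fun t ↦ Finset.measurable_sum _ fun i _ ↦ (hGm t).comp (measurable_pi_apply i))
    (integral_sum_indepCopy hG hG0 n) fun s t ↦ ?_
  rw [covFun_sum_indepCopy hG hG0]
  refine (h _ (NNReal.rpow_pos (by positivity)) s t).trans ?_
  rw [NNReal.coe_rpow, ← Real.rpow_mul (by positivity), one_div_mul_cancel hα.ne', Real.rpow_one]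
  simp

lemma IsSelfSimilar.covFun_mul_mul {h : ℝ} (hG : IsSelfSimilar h G P) (a : ℝ≥0) (ha : 0 < a)
    (s t : ℝ≥0) : covFun G P (a * s) (a * t) = (a : ℝ) ^ (2 * h) * covFun G P s t := by
  refine ((hG a ha).covFun_eq s t).trans ?_
  rw [two_mul, Real.rpow_add (by exact_mod_cast ha), covFun, covFun, ← integral_const_mul]
  congr with ω
  ring

lemma isSelfSimilar_of_covFun_mul_mul (hGm : ∀ t, Measurable (G t))
    (hG : IsGaussianProcess G P) (hG0 : ∀ t, ∫ ω, G t ω ∂P = 0) {h : ℝ}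
    (hcov : ∀ a : ℝ≥0, 0 < a → ∀ s t : ℝ≥0,
      covFun G P (a * s) (a * t) = (a : ℝ) ^ (2 * h) * covFun G P s t) : IsSelfSimilar h G P := by
  intro a ha
  refine sameLaw_of_covFun_eq (hG.comp_right fun t ↦ a * t) (fun t ↦ hGm _) (fun t ↦ hG0 _)
    (hG.smul fun _ ↦ (a : ℝ) ^ h) (fun t ↦ (hGm t).const_mul _)
    (fun t ↦ by simp [integral_const_mul, hG0]) fun s t ↦ ?_
  refine (hcov a ha s t).trans ?_
  rw [two_mul, Real.rpow_add (by exact_mod_cast ha)]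
  rw [covFun, covFun, ← integral_const_mul]
  congr with ω
  ring

lemma isGaussianProcess_lamperti (hG : IsGaussianProcess G P) (h : ℝ) :
    IsGaussianProcess (lamperti h G) P :=
  (hG.comp_right nnexp).smul
    fun y ↦ Real.exp (-h * y)

/-- If the covariance function is homogeneous, that of the Lamperti transform is translation
invariant. -/
lemma covFun_lamperti_add {h : ℝ}
    (hcov : ∀ a : ℝ≥0, 0 < a → ∀ s t : ℝ≥0,
      covFun G P (a * s) (a * t) = (a : ℝ) ^ (2 * h) * covFun G P s t) (y z r : ℝ) :
    covFun (lamperti h G) P (y + r) (z + r) = covFun (lamperti h G) P y z := by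
  rw [covFun_lamperti, covFun_lamperti, add_comm y, add_comm z, nnexp_add, nnexp_add,
    hcov _ (nnexp_pos r), ← mul_assoc, coe_nnexp, ← Real.exp_mul, ← Real.exp_add]
  ring_nf

lemma isStationary_lamperti_of_covFun_mul_mul (hGm : ∀ t, Measurable (G t))
    (hG : IsGaussianProcess G P) (hG0 : ∀ t, ∫ ω, G t ω ∂P = 0) {h : ℝ}
    (hcov : ∀ a : ℝ≥0, 0 < a → ∀ s t : ℝ≥0,
      covFun G P (a * s) (a * t) = (a : ℝ) ^ (2 * h) * covFun G P s t) :
    IsStationary (lamperti h G) P := by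
  intro r
  have hm : ∀ y, Measurable (lamperti h G y) := fun y ↦ (hGm _).const_mul _
  have h0 : ∀ y, ∫ ω, lamperti h G y ω ∂P = 0 := fun y ↦ by
    simp only [lamperti_apply, integral_const_mul, hG0, mul_zero]
  have hL := isGaussianProcess_lamperti hG h
  exact sameLaw_of_covFun_eq (hL.comp_right fun y ↦ y + r) (fun y ↦ hm _) (fun y ↦ h0 _) hL hm h0
    fun y z ↦ covFun_lamperti_add hcov y z r

/-- If the covariance function of the Lamperti transform is translation invariant, then that of `G`
is homogeneous at positive times. -/
lemma covFun_mul_mul_of_lamperti_add {h : ℝ}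
    (hinv : ∀ y z r, covFun (lamperti h G) P (y + r) (z + r) = covFun (lamperti h G) P y z)
    (a s t : ℝ≥0) (ha : 0 < a) (hs : 0 < s) (ht : 0 < t) :
    covFun G P (a * s) (a * t) = (a : ℝ) ^ (2 * h) * covFun G P s t := by
  have ha' : (0 : ℝ) < a := ha
  have hs' : (0 : ℝ) < s := hs
  have ht' : (0 : ℝ) < t := ht
  rw [covFun_eq_lamperti h G P (mul_pos ha hs) (mul_pos ha ht), covFun_eq_lamperti h G P hs ht,
    NNReal.coe_mul, NNReal.coe_mul, Real.log_mul ha'.ne' hs'.ne', Real.log_mul ha'.ne' ht'.ne',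
    add_comm (Real.log a), add_comm (Real.log a), hinv, two_mul, Real.rpow_add ha']
  simp only [Real.mul_rpow, ha'.le, hs'.le, ht'.le, mul_nonneg]
  ring

lemma IsSpectralMeasure.covFun_add {Y : ℝ → Ω → ℝ} {μ : Measure ℝ} (h : IsSpectralMeasure Y P μ)
    (y z r : ℝ) : covFun Y P (y + r) (z + r) = covFun Y P y z := by
  have := (h.covFun_eq (y + r) (z + r)).trans
    ((by rw [add_sub_add_right_eq_sub] : _ = _).trans (h.covFun_eq y z).symm)
  exact_mod_cast this

/-- A Gaussian process on the line with continuous, translation invariant covariance function has a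
spectral measure, by Bochner's theorem applied to `x ↦ E[Y 0 * Y x]`. -/
lemma exists_isSpectralMeasure {Y : ℝ → Ω → ℝ} (hY : IsGaussianProcess Y P)
    (hc : Continuous fun x ↦ covFun Y P 0 x)
    (hinv : ∀ y z r, covFun Y P (y + r) (z + r) = covFun Y P y z) :
    ∃ μ, IsSpectralMeasure Y P μ := by
  set r : ℝ → ℝ := fun x ↦ covFun Y P 0 x
  have hr : ∀ y z, covFun Y P y z = r (z - y) := fun y z ↦ by
    simpa [r] using hinv 0 (z - y) y
  have heven : ∀ x, r (-x) = r x := fun x ↦ by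
    have := hr x 0
    rw [zero_sub] at this
    rw [← this, covFun_comm]
  have hpd : IsPosDefFun r := by
    intro n x c
    have hint : ∀ i j, Integrable (fun ω ↦ (c i * Y (x i) ω) * (c j * Y (x j) ω)) P := fun i j ↦
      ((hY.integrable_mul (x i) (x j)).const_mul (c i * c j)).congr
        (ae_of_all _ fun ω ↦ by ring)
    have h0 : 0 ≤ ∫ ω, (∑ i, c i * Y (x i) ω) * (∑ j, c j * Y (x j) ω) ∂P :=
      integral_nonneg fun ω ↦ mul_self_nonneg _
    simp only [Finset.sum_mul_sum] at h0
    rw [integral_finsetSum _ fun i _ ↦ integrable_finsetSum _ fun j _ ↦ hint i j] at h0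
    refine h0.trans_eq (Finset.sum_congr rfl fun i _ ↦ ?_)
    rw [integral_finsetSum _ fun j _ ↦ hint i j]
    refine Finset.sum_congr rfl fun j _ ↦ ?_
    rw [← neg_sub, heven, ← hr, covFun, ← integral_const_mul]
    congr with ω
    ring
  obtain ⟨μ, hμ, hμr⟩ := hpd.exists_charFun_eq hc heven
  refine ⟨μ, hμ, ?_, fun y z ↦ ?_⟩
  · have hfin : IsFiniteMeasure (μ.map fun u ↦ -u) := inferInstance
    refine Measure.ext_of_charFun ?_
    ext t
    have h1 := charFun_map_mul (μ := μ) (-1) t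
    simp only [neg_mul, one_mul] at h1
    rw [h1, hμr, hμr, heven]
  · have habs : r |y - z| = r (y - z) := by
      rcases abs_choice (y - z) with h | h <;> rw [h]
      exact heven _
    rw [hr, ← neg_sub, heven, ← habs, ← hμr, charFun_apply_real]
    congr with u
    ring_nf

lemma continuous_covFun_lamperti (h : ℝ)
    (hc : Continuous fun p : ℝ≥0 × ℝ≥0 ↦ covFun G P p.1 p.2) (y : ℝ) :
    Continuous fun z ↦ covFun (lamperti h G) P y z := by
  simp only [covFun_lamperti]
  exact (by fun_prop : Continuous fun z ↦ Real.exp (-h * (y + z))).mul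
    (hc.comp (continuous_const.prodMk continuous_nnexp))

/-- The spectral representation of the Lamperti transform, read off for the process itself. -/
lemma IsSpectralMeasure.covFun_eq_integral {h : ℝ} {μ : Measure ℝ}
    (hμ : IsSpectralMeasure (lamperti h G) P μ) {s t : ℝ≥0} (hs : 0 < s) (ht : 0 < t) :
    (covFun G P s t : ℂ) = (((s : ℝ) * (t : ℝ)) ^ h : ℝ) *
      ∫ u : ℝ, Complex.exp (Complex.I * u * (|Real.log ((s : ℝ) / (t : ℝ))| : ℝ)) ∂μ := by
  have hs' : (s : ℝ) ≠ 0 := by positivity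
  have ht' : (t : ℝ) ≠ 0 := by positivity
  rw [covFun_eq_lamperti h G P hs ht, Complex.ofReal_mul, hμ.covFun_eq, Real.log_div hs' ht']

end Scaling

end AlphaIDT

theorem mainTheorem1 {Ω : Type*} [MeasurableSpace Ω] (P : Measure Ω) [IsProbabilityMeasure P]
    (α : ℝ) (hα : 0 < α) (G : ℝ≥0 → Ω → ℝ) (hmeas : ∀ t, Measurable (G t))
    (hgauss : IsGaussianProcess G P) (hcentered : ∀ t, ∫ ω, G t ω ∂P = 0)
    (hcont : AlphaIDT.IsContinuousInProbability G P) :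
    List.TFAE
      [ AlphaIDT.IsIDT α G P,
        ∀ a : ℝ≥0, 0 < a → ∀ s t : ℝ≥0, s ≤ t →
          AlphaIDT.covFun G P (a * s) (a * t) = (a : ℝ) ^ α * AlphaIDT.covFun G P s t,
        AlphaIDT.IsSelfSimilar (α / 2) G P,
        AlphaIDT.IsStationary (AlphaIDT.lamperti (α / 2) G) P,
        ∃ μ : Measure ℝ, AlphaIDT.IsSpectralMeasure (AlphaIDT.lamperti (α / 2) G) P μ ] ∧
    ∀ μ : Measure ℝ, AlphaIDT.IsSpectralMeasure (AlphaIDT.lamperti (α / 2) G) P μ →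
      (∀ s t : ℝ≥0, 0 < s → 0 < t →
        (AlphaIDT.covFun G P s t : ℂ) =
          (((s : ℝ) * (t : ℝ)) ^ (α / 2) : ℝ) *
            ∫ u : ℝ, Complex.exp (Complex.I * u * (|Real.log ((s : ℝ) / (t : ℝ))| : ℝ)) ∂μ) ∧
      (∀ s t : ℝ≥0, s = 0 ∨ t = 0 → AlphaIDT.covFun G P s t = 0) := by
  have hc := AlphaIDT.continuous_covFun hgauss hcentered hcont
  have h2 : 2 * (α / 2) = α := by ring
  have hsymm : (∀ a : ℝ≥0, 0 < a → ∀ s t : ℝ≥0, s ≤ t →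
      AlphaIDT.covFun G P (a * s) (a * t) = (a : ℝ) ^ α * AlphaIDT.covFun G P s t) →
      ∀ a : ℝ≥0, 0 < a → ∀ s t : ℝ≥0,
        AlphaIDT.covFun G P (a * s) (a * t) =
          (a : ℝ) ^ (2 * (α / 2)) * AlphaIDT.covFun G P s t := by
    intro h a ha s t
    rw [h2]
    rcases le_total s t with hst | hst
    · exact h a ha s t hst
    · rw [AlphaIDT.covFun_comm, h a ha t s hst, AlphaIDT.covFun_comm]
  have hinv : (∀ y z r, AlphaIDT.covFun (AlphaIDT.lamperti (α / 2) G) P (y + r) (z + r) =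
      AlphaIDT.covFun (AlphaIDT.lamperti (α / 2) G) P y z) →
      ∀ a : ℝ≥0, 0 < a → ∀ s t : ℝ≥0,
        AlphaIDT.covFun G P (a * s) (a * t) = (a : ℝ) ^ α * AlphaIDT.covFun G P s t :=
    fun h ↦ AlphaIDT.covFun_mul_mul_of_pos hα hgauss hc fun a s t ha hs ht ↦ by
      rw [AlphaIDT.covFun_mul_mul_of_lamperti_add h a s t ha hs ht, h2]
  refine ⟨?_, fun μ hμ ↦ ⟨fun s t hs ht ↦ hμ.covFun_eq_integral hs ht, ?_⟩⟩
  · tfae_have 1 → 2 := fun h a _ s t _ ↦ h.covFun_mul_mul hα hgauss hcentered hc a s t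
    tfae_have 2 → 1 := fun h ↦
      AlphaIDT.isIDT_of_covFun_mul_mul hα hmeas hgauss hcentered (h2 ▸ hsymm h)
    tfae_have 2 → 3 := fun h ↦
      AlphaIDT.isSelfSimilar_of_covFun_mul_mul hmeas hgauss hcentered (hsymm h)
    tfae_have 3 → 2 := fun h a ha s t _ ↦ by rw [h.covFun_mul_mul a ha s t, h2]
    tfae_have 2 → 4 := fun h ↦
      AlphaIDT.isStationary_lamperti_of_covFun_mul_mul hmeas hgauss hcentered (hsymm h)
    tfae_have 4 → 2 := fun h a ha s t _ ↦ hinv (fun y z r ↦ (h r).covFun_eq y z) a ha s t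
    tfae_have 2 → 5 := fun h ↦
      AlphaIDT.exists_isSpectralMeasure (AlphaIDT.isGaussianProcess_lamperti hgauss _)
        (AlphaIDT.continuous_covFun_lamperti _ hc 0) (AlphaIDT.covFun_lamperti_add (hsymm h))
    tfae_have 5 → 2 := fun ⟨_, hμ⟩ a ha s t _ ↦ hinv hμ.covFun_add a ha s t
    tfae_finish
  · have h0 : ∀ t, AlphaIDT.covFun G P 0 t = 0 :=
      AlphaIDT.covFun_zero_left hα hgauss hc fun a ha ↦ by
        simpa using hinv hμ.covFun_add a ha 1 1
    rintro s t (rfl | rfl)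
    · exact h0 t
    · rw [AlphaIDT.covFun_comm, h0]
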